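/- Let $H_n$ be the physicists' Hermite polynomials ($H_0=1$, $H_{n+1}(y)=2yH_n(y)-H_n'(y)$). For $\nu\in(-\frac{\pi}{4},\frac{\pi}{4})$ consider the biorthogonal families of the Swanson model $$\varphi_n(x)=\frac{N_1}{\sqrt{2^nn!}}H_n(e^{i\nu}x)\,e^{-\frac12e^{2i\nu}x^2},\qquad \Psi_n(x)=\frac{N_2}{\sqrt{2^nn!}}H_n(e^{-i\nu}x)\,e^{-\frac12e^{-2i\nu}x^2},\qquad x\in\mathbb R,\ n\ge 0,$$ where $N_1=N_1(\nu)$ and $N_2=N_2(\nu)$ are arbitrary non-zero complex normalization constants (for instance $N_1=1$ and $N_2$ such that $\langle\varphi_0,\Psi_0\rangle=1$). For $z=re^{i\theta}\in\mathbb C$ put $\lambda(z)=-\frac12\log\cosh r$ and $\lambda_b(z)=-\frac12e^{i\theta}\tanh r$, and consider the series of the (non-regular) bi-squeezed states $$\tau_z=e^{\lambda(z)}\sum_{k\ge0}\frac{\lambda_b(z)^k}{k!}\sqrt{(2k)!}\,\varphi_{2k},\qquad \kappa_z=e^{\lambda(z)}\sum_{k\ge0}\frac{\lambda_b(z)^k}{k!}\sqrt{(2k)!}\,\Psi_{2k}.$$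 For $0<|\nu|<\frac{\pi}{4}$ let $$\rho_\nu=\tanh^{-1}\left[\left(\frac1{\cos 2\nu}+\Big(\frac1{\cos^2 2\nu}-1\Big)^{1/2}\right)^{-2}\right].$$ Then: 1. If $0<|\nu|<\frac{\pi}{4}$, then $\rho_\nu>0$ and for every $z\in\mathbb C$ with $|z|<\rho_\nu$ both series converge in $L^2(\mathbb R)$, absolutely (the $L^2$ norms of their terms have a finite sum). If $\nu=0$, both series converge in this sense for every $z\in\mathbb C$. 2. $\rho_\nu\to0$ as $\nu\to\frac{\pi}{4}^-$ and as $\nu\to-\frac{\pi}{4}^+$, and $\rho_\nu\to+\infty$ as $\nu\to0$, $\nu\neq0$. 3. The radius of convergence in $L^2(\mathbb R)$ of the series of $\tau_z$, that is, the supremum in $[0,\infty]$ of all $R\geq 0$ such that the series converges in $L^2(\mathbb R)$ for all $|z|<R$, tends to $0$ as $\nu\to\frac{\pi}{4}^-$ and as $\nu\to-\frac{\pi}{4}^+$, and tends to $\infty$ as $\nu\to0$, $\nu\ne0$. The same holds for the radius of convergence of the series of $\kappa_z$. -/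

import Mathlib

open MeasureTheory Filter Topology Set
open scoped NNReal ENNReal

noncomputable section

namespace Swanson

/-- The physicists' Hermite polynomials `H_n`, given by `H_0 = 1` and
`H_{n+1} = 2 X H_n - H_n'`. -/
def hermiteH : ℕ → Polynomial ℂ
  | 0 => 1
  | n + 1 => 2 * Polynomial.X * hermiteH n - Polynomial.derivative (hermiteH n)

/-- The function
`x ↦ N / √(2^n n!) * H_n (e^{iν} x) * exp (-(1/2) e^{2iν} x^2)`. -/
def phi (N : ℂ) (ν : ℝ) (n : ℕ) (x : ℝ) : ℂ :=
  N / (Real.sqrt (2 ^ n * (n.factorial : ℝ)) : ℂ)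
    * (hermiteH n).eval (Complex.exp (Complex.I * ν) * x)
    * Complex.exp (-(1 / 2) * Complex.exp (2 * Complex.I * ν) * (x : ℂ) ^ 2)

/-- The function
`x ↦ N / √(2^n n!) * H_n (e^{-iν} x) * exp (-(1/2) e^{-2iν} x^2)`. -/
def psi (N : ℂ) (ν : ℝ) (n : ℕ) (x : ℝ) : ℂ :=
  N / (Real.sqrt (2 ^ n * (n.factorial : ℝ)) : ℂ)
    * (hermiteH n).eval (Complex.exp (-(Complex.I * ν)) * x)
    * Complex.exp (-(1 / 2) * Complex.exp (-(2 * Complex.I * ν)) * (x : ℂ) ^ 2)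

/-- `λ(z) = -(1/2) log (cosh |z|)`. -/
def lam (z : ℂ) : ℝ := -(1 / 2) * Real.log (Real.cosh ‖z‖)

/-- `λ_b(z) = -(1/2) e^{iθ} tanh r` for `z = r e^{iθ}`. -/
def lamB (z : ℂ) : ℂ :=
  -(1 / 2) * Complex.exp (Complex.I * (Complex.arg z : ℂ)) * (Real.tanh ‖z‖ : ℂ)

/-- The `k`-th term `e^{λ(z)} λ_b(z)^k / k! * √((2k)!) * f_{2k}` of the squeezed-state series
built on the family `f`. -/
def squeezedTerm (f : ℕ → ℝ → ℂ) (z : ℂ) (k : ℕ) (x : ℝ) : ℂ :=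
  (Real.exp (lam z) : ℂ) * (lamB z ^ k / (k.factorial : ℂ)
    * (Real.sqrt ((2 * k).factorial : ℝ) : ℂ)) * f (2 * k) x

/-- The terms of the series defining the state `τ_z`. -/
def tauTerm (N₁ : ℂ) (ν : ℝ) (z : ℂ) : ℕ → ℝ → ℂ := squeezedTerm (phi N₁ ν) z

/-- The terms of the series defining the state `κ_z`. -/
def kappaTerm (N₂ : ℂ) (ν : ℝ) (z : ℂ) : ℕ → ℝ → ℂ := squeezedTerm (psi N₂ ν) z

/-- The series of functions `∑ u k` converges in `L²(ℝ)`: its terms are square integrable and its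
partial sums converge in the norm of `L²(ℝ)` to a square integrable function. -/
def ConvergesL2 (u : ℕ → ℝ → ℂ) : Prop :=
  (∀ k, MemLp (u k) 2 volume) ∧
    ∃ g : ℝ → ℂ, MemLp g 2 volume ∧
      Tendsto (fun n => eLpNorm (fun x => (∑ k ∈ Finset.range n, u k x) - g x) 2 volume)
        atTop (𝓝 0)

/-- The series `∑ u k` converges absolutely in `L²(ℝ)`: it converges there, and the sum of the
`L²` norms of its terms is finite. -/
def ConvergesAbsL2 (u : ℕ → ℝ → ℂ) : Prop :=
  ConvergesL2 u ∧ ∑' k, eLpNorm (u k) 2 volume < ∞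

/-- The radius of convergence in `L²(ℝ)` of a series depending on `z ∈ ℂ`: the supremum of the
radii `r` such that the series converges for all `|z| < r`. -/
def radius (u : ℂ → ℕ → ℝ → ℂ) : ℝ≥0∞ :=
  ⨆ (r : ℝ≥0) (_ : ∀ z : ℂ, ‖z‖ < (r : ℝ) → ConvergesL2 (u z)), (r : ℝ≥0∞)

/-- `ρ_ν = tanh⁻¹ [(1 / cos 2ν + (1 / cos² 2ν - 1)^{1/2})⁻²]`, finite for `0 < |ν| < π/4`. -/
def rho (ν : ℝ) : ℝ :=
  Real.artanh (((1 / Real.cos (2 * ν)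
    + Real.sqrt (1 / Real.cos (2 * ν) ^ 2 - 1)) ^ 2)⁻¹)

end Swanson

end

/-! ### Hermite polynomials and the Gaussian moment functional. -/

section HermiteGaussian

open Polynomial

namespace Swanson

/-! Write `c = cos 2ν`. The substitution `y = √c x` turns `‖φ_n‖²` into a constant times the
integral of `|H_n(b y)|² exp(-y²)`, divided by `2^n n!`, with `b = e^{iν} / √c`. The multiplication
theorem expands `H_n(b y)` in the `H_j`, and Parseval gives a finite sum of nonnegative terms,
`hermiteNormSq b n`. Its top term gives the lower bound `|b|^{2n} = (1/c)^n`; comparison with the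
binomial theorem gives the upper bound `A^n`, where `A = |b|² + |b² - 1|` is `growthRate ν`.

The squared scalar factor of the `k`-th term is, up to a constant in `k`, `tanh^{2k} |z|` times
`centralBinom k / 4^k`, and the latter lies between `1/(2k+1)` and `1`. Hence the norms are
dominated by a geometric series when `A tanh |z| < 1` (`convergesAbsL2_tauTerm`) and stay away from
zero when `tanh |z| > c` (`tanh_le_cos_of_convergesL2_tauTerm`).

For `ν ≠ 0` one has `A > 1`, so `tanh |z| < A⁻²` suffices, and the radius of convergence lies
between `ρ_ν` and `artanh c`. As `ν → ±π/4` the upper bound tends to zero; as `ν → 0` the lower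
bound tends to infinity. At `ν = 0`, `A = 1` and `tanh < 1` always. The series of `κ_z` is that of
`τ_z` with `ν` replaced by `-ν`. -/

lemma hermiteH_succ (n : ℕ) :
    hermiteH (n + 1) = 2 * X * hermiteH n - derivative (hermiteH n) := rfl

lemma derivative_hermiteH_succ (n : ℕ) :
    derivative (hermiteH (n + 1)) = 2 * ((n : ℂ[X]) + 1) * hermiteH n := by
  induction n with
  | zero => simp [hermiteH]
  | succ n ih =>
    rw [hermiteH_succ (n + 1), derivative_sub, derivative_mul, ih]
    have h2 : derivative (2 * X : ℂ[X]) = 2 := by simp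
    have h3 : derivative (2 * ((n : ℂ[X]) + 1) * hermiteH n)
        = 2 * ((n : ℂ[X]) + 1) * derivative (hermiteH n) := by
      have : derivative (2 * ((n : ℂ[X]) + 1)) = 0 := by simp
      rw [derivative_mul, this]; ring
    rw [h2, h3, hermiteH_succ n]
    push_cast
    ring

lemma hermiteH_add_two (n : ℕ) :
    hermiteH (n + 2) = 2 * X * hermiteH (n + 1) - 2 * ((n : ℂ[X]) + 1) * hermiteH n := by
  rw [hermiteH_succ (n + 1), derivative_hermiteH_succ]

lemma map_conj_hermiteH (n : ℕ) : (hermiteH n).map (starRingEnd ℂ) = hermiteH n := by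
  induction n with
  | zero => simp [hermiteH]
  | succ n ih =>
    rw [hermiteH_succ, Polynomial.map_sub, Polynomial.map_mul, ← derivative_map, ih]
    simp

/-- This makes `|p|²` on the real line the polynomial `p * p.map conj`, to which the moment
functional applies. -/
lemma eval_ofReal_map_conj (p : ℂ[X]) (x : ℝ) :
    (p.map (starRingEnd ℂ)).eval (x : ℂ) = starRingEnd ℂ (p.eval (x : ℂ)) := by
  have h := Polynomial.eval_map_apply (p := p) (starRingEnd ℂ) (x : ℂ)
  rwa [Complex.conj_ofReal] at h

/-- Polynomials are integrable against the Gaussian weight. -/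
lemma integrable_eval_mul_gaussian (p : ℂ[X]) :
    Integrable (fun x : ℝ => p.eval (x : ℂ) * (Real.exp (-x ^ 2) : ℂ)) := by
  induction p using Polynomial.induction_on' with
  | add p q hp hq =>
    simp only [eval_add, add_mul]
    exact hp.add hq
  | monomial n a =>
    have h := integrable_rpow_mul_exp_neg_mul_sq (b := 1) one_pos (s := n)
      (lt_of_lt_of_le (by norm_num) n.cast_nonneg)
    have h' := (h.ofReal (𝕜 := ℂ)).const_mul a
    refine h'.congr (Eventually.of_forall fun x => ?_)
    simp [mul_assoc]

/-- The moment functional of the Gaussian weight `exp (-x²)`. -/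
noncomputable def gaussInt (p : ℂ[X]) : ℂ := ∫ x : ℝ, p.eval (x : ℂ) * (Real.exp (-x ^ 2) : ℂ)

lemma gaussInt_add (p q : ℂ[X]) : gaussInt (p + q) = gaussInt p + gaussInt q := by
  simp only [gaussInt, eval_add, add_mul]
  exact integral_add (integrable_eval_mul_gaussian p) (integrable_eval_mul_gaussian q)

lemma gaussInt_C_mul (a : ℂ) (p : ℂ[X]) : gaussInt (C a * p) = a * gaussInt p := by
  simp only [gaussInt, eval_mul, eval_C, mul_assoc]
  exact integral_const_mul _ _

lemma gaussInt_zero : gaussInt 0 = 0 := by simp [gaussInt]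

lemma gaussInt_sum {ι : Type*} (s : Finset ι) (f : ι → ℂ[X]) :
    gaussInt (∑ i ∈ s, f i) = ∑ i ∈ s, gaussInt (f i) := by
  classical
  induction s using Finset.induction_on with
  | empty => simp [gaussInt_zero]
  | insert a s ha ih => rw [Finset.sum_insert ha, Finset.sum_insert ha, gaussInt_add, ih]

lemma gaussInt_one : gaussInt 1 = (Real.sqrt Real.pi : ℂ) := by
  have h := integral_gaussian 1
  simp only [neg_mul, one_mul, div_one] at h
  simp only [gaussInt, eval_one, one_mul]
  rw [integral_complex_ofReal, h]

/-- Integration by parts against the Gaussian weight. -/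
lemma gaussInt_two_X_mul (p : ℂ[X]) : gaussInt (2 * X * p) = gaussInt (derivative p) := by
  have hd : ∀ x : ℝ, HasDerivAt (fun x : ℝ => p.eval (x : ℂ) * (Real.exp (-x ^ 2) : ℂ))
      ((derivative p - 2 * X * p).eval (x : ℂ) * (Real.exp (-x ^ 2) : ℂ)) x := by
    intro x
    have h1 : HasDerivAt (fun x : ℝ => p.eval (x : ℂ)) ((derivative p).eval (x : ℂ)) x :=
      (p.hasDerivAt (x : ℂ)).comp_ofReal
    have h2 : HasDerivAt (fun x : ℝ => Real.exp (-x ^ 2)) (Real.exp (-x ^ 2) * (-(2 * x))) x := by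
      have := ((hasDerivAt_pow 2 x).neg).exp
      simpa using this
    refine (h1.mul h2.ofReal_comp).congr_deriv ?_
    simp only [eval_sub, eval_mul, eval_X, eval_ofNat]
    push_cast
    ring
  have h0 := integral_eq_zero_of_hasDerivAt_of_integrable hd
    (integrable_eval_mul_gaussian _) (integrable_eval_mul_gaussian _)
  change gaussInt (derivative p - 2 * X * p) = 0 at h0
  have h3 := gaussInt_add (derivative p - 2 * X * p) (2 * X * p)
  rw [h0, sub_add_cancel, zero_add] at h3
  exact h3.symm

/-- The raising operator `2X - d/dX` is the adjoint of `d/dX` for the Gaussian weight. -/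
lemma gaussInt_hermiteH_succ_mul (n : ℕ) (q : ℂ[X]) :
    gaussInt (hermiteH (n + 1) * q) = gaussInt (hermiteH n * derivative q) := by
  have h := gaussInt_two_X_mul (hermiteH n * q)
  have h1 : 2 * X * (hermiteH n * q) = hermiteH (n + 1) * q + derivative (hermiteH n) * q := by
    rw [hermiteH_succ]; ring
  rw [h1, derivative_mul, gaussInt_add, gaussInt_add] at h
  exact add_right_cancel (h.trans (add_comm _ _))

/-- Orthogonality of the Hermite polynomials. -/
lemma gaussInt_hermiteH_mul_hermiteH (m n : ℕ) :
    gaussInt (hermiteH m * hermiteH n)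
      = if m = n then 2 ^ n * (n.factorial : ℂ) * (Real.sqrt Real.pi : ℂ) else 0 := by
  -- Each step below lowers both indices by one, so unequal indices end here, where the derivative
  -- of the constant `H_0` vanishes.
  have h0 : ∀ k, gaussInt (hermiteH (k + 1) * hermiteH 0) = 0 := fun k => by
    rw [gaussInt_hermiteH_succ_mul]; simp [hermiteH, gaussInt_zero]
  induction m generalizing n with
  | zero =>
    cases n with
    | zero => simp [hermiteH, gaussInt_one]
    | succ n => rw [mul_comm, h0]; simp
  | succ m ih =>
    cases n with
    | zero => rw [h0]; simp
    | succ n =>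
      have h1 : hermiteH m * (2 * ((n : ℂ[X]) + 1) * hermiteH n)
          = C (2 * ((n : ℂ) + 1)) * (hermiteH m * hermiteH n) := by
        simp only [map_mul, map_add, map_ofNat, map_natCast, map_one]; ring
      rw [gaussInt_hermiteH_succ_mul, derivative_hermiteH_succ, h1, gaussInt_C_mul, ih]
      by_cases h : m = n
      · simp [h, Nat.factorial_succ]; ring
      · simp [h]

lemma integral_norm_sq_eval_mul_gaussian (p : ℂ[X]) :
    ((∫ x : ℝ, ‖p.eval (x : ℂ)‖ ^ 2 * Real.exp (-x ^ 2) : ℝ) : ℂ)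
      = gaussInt (p * p.map (starRingEnd ℂ)) := by
  rw [← integral_complex_ofReal, gaussInt]
  congr 1
  ext x
  rw [eval_mul, eval_ofReal_map_conj, Complex.mul_conj, Complex.normSq_eq_norm_sq]
  push_cast
  rfl

/-- Parseval's identity for finite Hermite expansions. -/
lemma integral_norm_sq_sum_hermiteH (s : Finset ℕ) (a : ℕ → ℂ) :
    ∫ x : ℝ, ‖(∑ j ∈ s, C (a j) * hermiteH j).eval (x : ℂ)‖ ^ 2 * Real.exp (-x ^ 2)
      = ∑ j ∈ s, ‖a j‖ ^ 2 * (2 ^ j * j.factorial * Real.sqrt Real.pi) := by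
  have h := integral_norm_sq_eval_mul_gaussian (∑ j ∈ s, C (a j) * hermiteH j)
  have h2 : gaussInt ((∑ j ∈ s, C (a j) * hermiteH j)
        * (∑ j ∈ s, C (a j) * hermiteH j).map (starRingEnd ℂ))
      = ∑ j ∈ s, (a j * starRingEnd ℂ (a j))
        * (2 ^ j * (j.factorial : ℂ) * (Real.sqrt Real.pi : ℂ)) := by
    simp only [Polynomial.map_sum, Polynomial.map_mul, map_C, map_conj_hermiteH]
    rw [Finset.sum_mul_sum, gaussInt_sum]
    refine Finset.sum_congr rfl fun i hi => ?_
    rw [gaussInt_sum, Finset.sum_eq_single i]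
    · rw [show C (a i) * hermiteH i * (C (starRingEnd ℂ (a i)) * hermiteH i)
          = C (a i * starRingEnd ℂ (a i)) * (hermiteH i * hermiteH i) by rw [C_mul]; ring,
        gaussInt_C_mul, gaussInt_hermiteH_mul_hermiteH, if_pos rfl]
    · intro j _ hj
      rw [show C (a i) * hermiteH i * (C (starRingEnd ℂ (a j)) * hermiteH j)
          = C (a i * starRingEnd ℂ (a j)) * (hermiteH i * hermiteH j) by rw [C_mul]; ring,
        gaussInt_C_mul, gaussInt_hermiteH_mul_hermiteH, if_neg (Ne.symm hj), mul_zero]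
    · exact fun h => absurd hi h
  rw [h2] at h
  apply Complex.ofReal_injective
  rw [h]
  push_cast
  refine Finset.sum_congr rfl fun j _ => ?_
  rw [Complex.mul_conj, Complex.normSq_eq_norm_sq]
  push_cast
  rfl

/-! ### Generating series and the multiplication theorem. -/

lemma powerSeries_derivative_mul {R : Type*} [CommRing R] (f g : PowerSeries R) :
    PowerSeries.derivative R (f * g)
      = f * PowerSeries.derivative R g + g * PowerSeries.derivative R f := by
  rw [Derivation.leibniz, smul_eq_mul, smul_eq_mul]

/-- The formal solution of `F' = A F` is determined by its constant coefficient. -/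
lemma powerSeries_eq_of_derivative_eq_mul {F G A : PowerSeries ℂ[X]}
    (hF : PowerSeries.derivative ℂ[X] F = A * F) (hG : PowerSeries.derivative ℂ[X] G = A * G)
    (h0 : PowerSeries.coeff 0 F = PowerSeries.coeff 0 G) : F = G := by
  ext1 n
  induction n using Nat.strong_induction_on with
  | _ n ih =>
    cases n with
    | zero => exact h0
    | succ n =>
      -- The equation expresses `(n + 1)` times the coefficient of index `n + 1` through those of
      -- index at most `n`.
      have h1 := PowerSeries.coeff_derivative F n
      have h2 := PowerSeries.coeff_derivative G n
      rw [hF, PowerSeries.coeff_mul] at h1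
      rw [hG, PowerSeries.coeff_mul] at h2
      have h3 : ((n : ℂ[X]) + 1) ≠ 0 := by exact_mod_cast n.succ_ne_zero
      apply mul_right_cancel₀ h3
      rw [← h1, ← h2]
      refine Finset.sum_congr rfl fun p hp => ?_
      have hp' : p.1 + p.2 = n := by simpa using hp
      rw [ih p.2 (by omega)]

/-- The coefficients of the power series of `exp (w t²)`. -/
noncomputable def expSqCoeff (w : ℂ) (i : ℕ) : ℂ :=
  if Even i then w ^ (i / 2) / ((i / 2).factorial : ℂ) else 0

lemma expSqCoeff_even (w : ℂ) (k : ℕ) : expSqCoeff w (2 * k) = w ^ k / (k.factorial : ℂ) := by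
  simp [expSqCoeff]

lemma expSqCoeff_odd (w : ℂ) (k : ℕ) : expSqCoeff w (2 * k + 1) = 0 := by
  simp [expSqCoeff]

lemma expSqCoeff_add_two (w : ℂ) (i : ℕ) :
    ((i : ℂ) + 2) * expSqCoeff w (i + 2) = 2 * w * expSqCoeff w i := by
  obtain ⟨k, rfl | rfl⟩ := Nat.even_or_odd' i
  · rw [show 2 * k + 2 = 2 * (k + 1) by ring, expSqCoeff_even, expSqCoeff_even,
      Nat.factorial_succ]
    have : ((k : ℂ) + 1) ≠ 0 := by exact_mod_cast k.succ_ne_zero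
    have : (k.factorial : ℂ) ≠ 0 := by exact_mod_cast k.factorial_ne_zero
    push_cast
    field_simp
    ring
  · rw [show 2 * k + 1 + 2 = 2 * (k + 1) + 1 by ring, expSqCoeff_odd, expSqCoeff_odd]
    simp

/-- The generating series of `H_n (b X)`, scaled by `d` in the formal variable. -/
noncomputable def hermiteSeries (b d : ℂ) : PowerSeries ℂ[X] :=
  PowerSeries.mk fun n => C (d ^ n / (n.factorial : ℂ)) * (hermiteH n).comp (C b * X)

/-- Formally the series is `exp (2 d b X t - d² t²)`. Coefficientwise the equation is the three-term
recurrence `hermiteH_add_two`. -/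
lemma derivative_hermiteSeries (b d : ℂ) :
    PowerSeries.derivative ℂ[X] (hermiteSeries b d)
      = (PowerSeries.C (2 * C (d * b) * X) - PowerSeries.C (C (2 * d ^ 2)) * PowerSeries.X)
        * hermiteSeries b d := by
  ext1 n
  rw [PowerSeries.coeff_derivative, sub_mul, map_sub, mul_assoc (PowerSeries.C (C (2 * d ^ 2))),
    PowerSeries.coeff_C_mul, PowerSeries.coeff_C_mul]
  cases n with
  | zero =>
    rw [PowerSeries.coeff_zero_X_mul]
    simp [hermiteSeries, hermiteH]
    ring
  | succ n =>
    rw [PowerSeries.coeff_succ_X_mul]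
    simp only [hermiteSeries, PowerSeries.coeff_mk]
    rw [hermiteH_add_two]
    have e1 : ((n + 1 : ℕ) : ℂ[X]) + 1 = C ((n : ℂ) + 2) := by
      rw [map_add, map_natCast, map_ofNat]; push_cast; ring
    have e2 : C (d ^ (n + 1 + 1) / ((n + 1 + 1).factorial : ℂ)) * C ((n : ℂ) + 2)
        = C (d * (d ^ (n + 1) / ((n + 1).factorial : ℂ))) := by
      rw [← C_mul, Nat.factorial_succ (n + 1)]
      congr 1
      have : ((n : ℂ) + 2) ≠ 0 := by exact_mod_cast (n + 1).succ_ne_zero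
      have : ((n + 1).factorial : ℂ) ≠ 0 := by exact_mod_cast (n + 1).factorial_ne_zero
      push_cast
      rw [show (n : ℂ) + 1 + 1 = n + 2 by ring]
      field_simp
      ring
    have e3 : C (d * (d ^ (n + 1) / ((n + 1).factorial : ℂ))) * ((n : ℂ[X]) + 1)
        = C (d ^ 2 * (d ^ n / (n.factorial : ℂ))) := by
      rw [show ((n : ℂ[X]) + 1) = C ((n : ℂ) + 1) by simp, ← C_mul, Nat.factorial_succ n]
      congr 1
      have : ((n : ℂ) + 1) ≠ 0 := by exact_mod_cast n.succ_ne_zero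
      have : (n.factorial : ℂ) ≠ 0 := by exact_mod_cast n.factorial_ne_zero
      push_cast
      field_simp
      ring
    rw [e1, mul_right_comm, e2]
    simp only [sub_comp, mul_comp, X_comp, ofNat_comp, add_comp, natCast_comp, one_comp]
    rw [mul_sub]
    have e4 : ∀ q : ℂ[X], C (d * (d ^ (n + 1) / ((n + 1).factorial : ℂ)))
        * (2 * ((n : ℂ[X]) + 1) * q) = 2 * (C (d ^ 2 * (d ^ n / (n.factorial : ℂ))) * q) := by
      intro q; rw [← e3]; ring
    simp only [Nat.cast_ofNat]
    rw [e4]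
    simp only [C_mul, map_ofNat]
    ring

lemma derivative_mk_expSqCoeff (w : ℂ) :
    PowerSeries.derivative ℂ[X] (PowerSeries.mk fun n => C (expSqCoeff w n))
      = PowerSeries.C (C (2 * w)) * PowerSeries.X
        * (PowerSeries.mk fun n => C (expSqCoeff w n)) := by
  ext1 n
  rw [PowerSeries.coeff_derivative, mul_assoc, PowerSeries.coeff_C_mul]
  cases n with
  | zero =>
    rw [PowerSeries.coeff_zero_X_mul]
    simp [expSqCoeff]
  | succ n =>
    rw [PowerSeries.coeff_succ_X_mul]
    simp only [PowerSeries.coeff_mk]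
    rw [← C_mul, ← expSqCoeff_add_two, show (((n + 1 : ℕ) : ℂ[X]) + 1) = C ((n : ℂ) + 2) by
      rw [map_add, map_natCast, map_ofNat]; push_cast; ring, ← C_mul, mul_comm]

/-- The multiplication theorem for Hermite polynomials, for generating series. -/
lemma hermiteSeries_eq_mul (b : ℂ) :
    hermiteSeries b 1
      = (PowerSeries.mk fun n => C (expSqCoeff (b ^ 2 - 1) n)) * hermiteSeries 1 b := by
  -- Formally `2bXt - t² = (b² - 1) t² + (2bXt - b² t²)`, so both sides have logarithmic derivative
  -- `2bX - 2t`.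
  refine powerSeries_eq_of_derivative_eq_mul (derivative_hermiteSeries b 1) ?_ ?_
  · rw [powerSeries_derivative_mul, derivative_hermiteSeries, derivative_mk_expSqCoeff]
    simp only [map_mul, map_sub, map_pow, map_one, map_ofNat]
    ring
  · simp [hermiteSeries, expSqCoeff, hermiteH]

/-- The multiplication theorem for Hermite polynomials. -/
lemma hermiteH_comp_C_mul_X (b : ℂ) (n : ℕ) :
    (hermiteH n).comp (C b * X) = ∑ j ∈ Finset.range (n + 1),
      C ((n.factorial : ℂ) * expSqCoeff (b ^ 2 - 1) (n - j) * (b ^ j / (j.factorial : ℂ)))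
        * hermiteH j := by
  have h := congrArg (PowerSeries.coeff n) (hermiteSeries_eq_mul b)
  rw [mul_comm, PowerSeries.coeff_mul, Finset.Nat.sum_antidiagonal_eq_sum_range_succ_mk] at h
  simp only [hermiteSeries, PowerSeries.coeff_mk, one_pow, map_one, one_mul, comp_X] at h
  have hn : (n.factorial : ℂ) ≠ 0 := by exact_mod_cast n.factorial_ne_zero
  have h2 : (hermiteH n).comp (C b * X)
      = C (n.factorial : ℂ) * (C (1 / (n.factorial : ℂ)) * (hermiteH n).comp (C b * X)) := by
    rw [← mul_assoc, ← C_mul, mul_one_div_cancel hn, C_1, one_mul]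
  rw [h2, h, Finset.mul_sum]
  refine Finset.sum_congr rfl fun j _ => ?_
  rw [C_mul, C_mul]
  ring

/-! ### Two-sided bounds for rescaled Hermite polynomials. -/

/-- The weighted square norm of the normalized `H_n (b x)`. -/
noncomputable def hermiteNormSq (b : ℂ) (n : ℕ) : ℝ :=
  ∑ j ∈ Finset.range (n + 1), ((n.factorial : ℝ) / j.factorial) *
    (‖expSqCoeff (b ^ 2 - 1) (n - j)‖ ^ 2 / 2 ^ (n - j)) * (‖b‖ ^ 2) ^ j

lemma integral_norm_sq_hermiteH (b : ℂ) (n : ℕ) :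
    ∫ x : ℝ, ‖(hermiteH n).eval (b * x)‖ ^ 2 * Real.exp (-x ^ 2)
      = 2 ^ n * n.factorial * Real.sqrt Real.pi * hermiteNormSq b n := by
  have h : ∀ x : ℝ, (hermiteH n).eval (b * x)
      = ((hermiteH n).comp (C b * X)).eval (x : ℂ) := by intro x; simp
  simp only [h]
  rw [hermiteH_comp_C_mul_X, integral_norm_sq_sum_hermiteH, hermiteNormSq, Finset.mul_sum]
  refine Finset.sum_congr rfl fun j hj => ?_
  have hj' : j ≤ n := Nat.lt_succ_iff.1 (Finset.mem_range.1 hj)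
  simp only [norm_mul, norm_div, norm_pow, RCLike.norm_natCast]
  have h1 : (2 : ℝ) ^ n = 2 ^ j * 2 ^ (n - j) := by rw [← pow_add]; congr 1; omega
  have : (j.factorial : ℝ) ≠ 0 := by exact_mod_cast j.factorial_ne_zero
  rw [h1]
  field_simp
  ring

/-- All summands are nonnegative; only `j = n` is kept. -/
lemma pow_le_hermiteNormSq (b : ℂ) (n : ℕ) : (‖b‖ ^ 2) ^ n ≤ hermiteNormSq b n := by
  have h : (‖b‖ ^ 2) ^ n = ((n.factorial : ℝ) / n.factorial) *
      (‖expSqCoeff (b ^ 2 - 1) (n - n)‖ ^ 2 / 2 ^ (n - n)) * (‖b‖ ^ 2) ^ n := by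
    have : (n.factorial : ℝ) ≠ 0 := by exact_mod_cast n.factorial_ne_zero
    simp [expSqCoeff, this]
  rw [h, hermiteNormSq]
  exact Finset.single_le_sum (f := fun j => ((n.factorial : ℝ) / j.factorial) *
    (‖expSqCoeff (b ^ 2 - 1) (n - j)‖ ^ 2 / 2 ^ (n - j)) * (‖b‖ ^ 2) ^ j)
    (fun j _ => by positivity) (Finset.mem_range.2 n.lt_succ_self)

lemma factorial_two_mul_eq_centralBinom_mul (k : ℕ) :
    ((2 * k).factorial : ℝ) = k.centralBinom * (k.factorial : ℝ) ^ 2 := by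
  have := Nat.choose_mul_factorial_mul_factorial (n := 2 * k) (k := k) (by omega)
  rw [show 2 * k - k = k by omega, ← Nat.centralBinom_eq_two_mul_choose] at this
  rw [← this]; push_cast; ring

/-- For `i = 2k` the ratio of the two sides is `centralBinom k / 4^k ≤ 1` (when `w ≠ 0`); for odd
`i` the left side is zero. -/
lemma factorial_mul_norm_sq_expSqCoeff_le (w : ℂ) (i : ℕ) :
    (i.factorial : ℝ) * (‖expSqCoeff w i‖ ^ 2 / 2 ^ i) ≤ ‖w‖ ^ i := by
  obtain ⟨k, rfl | rfl⟩ := Nat.even_or_odd' i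
  · have h2 : (k.centralBinom : ℝ) ≤ 4 ^ k := by exact_mod_cast k.centralBinom_le_four_pow
    have h3 : (k.factorial : ℝ) ≠ 0 := by exact_mod_cast k.factorial_ne_zero
    rw [expSqCoeff_even, factorial_two_mul_eq_centralBinom_mul, norm_div, norm_pow, RCLike.norm_natCast, pow_mul 2 2 k,
      show (k.centralBinom : ℝ) * (k.factorial : ℝ) ^ 2
        * ((‖w‖ ^ k / (k.factorial : ℝ)) ^ 2 / (2 ^ 2) ^ k)
        = ‖w‖ ^ (2 * k) * (k.centralBinom / 4 ^ k) by
          rw [show ((2 : ℝ) ^ 2) = 4 by norm_num]; field_simp; ring]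
    exact mul_le_of_le_one_right (by positivity) ((div_le_one (by positivity)).2 h2)
  · rw [expSqCoeff_odd]
    simp only [norm_zero]
    rw [zero_pow two_ne_zero, zero_div, mul_zero]
    positivity

/-- Since `n!/j! = (n choose j) (n-j)!`, the previous bound compares the sum termwise with the
binomial expansion. -/
lemma hermiteNormSq_le_pow (b : ℂ) (n : ℕ) :
    hermiteNormSq b n ≤ (‖b‖ ^ 2 + ‖b ^ 2 - 1‖) ^ n := by
  rw [add_pow, hermiteNormSq]
  refine Finset.sum_le_sum fun j hj => ?_
  have hj' : j ≤ n := Nat.lt_succ_iff.1 (Finset.mem_range.1 hj)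
  have h1 : ((n.factorial : ℝ) / j.factorial) = n.choose j * (n - j).factorial := by
    have : (j.factorial : ℝ) ≠ 0 := by exact_mod_cast j.factorial_ne_zero
    rw [div_eq_iff this]
    have := Nat.choose_mul_factorial_mul_factorial hj'
    rw [← this]; push_cast; ring
  have h2 := factorial_mul_norm_sq_expSqCoeff_le (b ^ 2 - 1) (n - j)
  calc _ = (‖b‖ ^ 2) ^ j * n.choose j * ((n - j).factorial *
        (‖expSqCoeff (b ^ 2 - 1) (n - j)‖ ^ 2 / 2 ^ (n - j))) := by rw [h1]; ring
    _ ≤ (‖b‖ ^ 2) ^ j * n.choose j * ‖b ^ 2 - 1‖ ^ (n - j) := by gcongr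
    _ = _ := by ring

end Swanson

end HermiteGaussian

namespace Swanson

/-! ### Norms of the functions `φ_n`. -/

section Norms

open Polynomial

lemma cos_two_mul_pos {ν : ℝ} (hν : ν ∈ Ioo (-(Real.pi / 4)) (Real.pi / 4)) :
    0 < Real.cos (2 * ν) :=
  Real.cos_pos_of_mem_Ioo ⟨by linarith [hν.1], by linarith [hν.2]⟩

/-- The parameter of the rescaled Hermite polynomials, `e^{iν} / √(cos 2ν)`. -/
noncomputable def hermiteScale (ν : ℝ) : ℂ :=
  Complex.exp (Complex.I * ν) / (Real.sqrt (Real.cos (2 * ν)) : ℂ)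

/-- The growth rate `1 / cos 2ν + (1 / cos² 2ν - 1)^{1/2}`. -/
noncomputable def growthRate (ν : ℝ) : ℝ :=
  1 / Real.cos (2 * ν) + Real.sqrt (1 / Real.cos (2 * ν) ^ 2 - 1)

lemma norm_exp_I_mul (ν : ℝ) : ‖Complex.exp (Complex.I * ν)‖ = 1 := by
  rw [mul_comm]; exact Complex.norm_exp_ofReal_mul_I ν

lemma norm_hermiteScale_sq {ν : ℝ} (hc : 0 < Real.cos (2 * ν)) :
    ‖hermiteScale ν‖ ^ 2 = 1 / Real.cos (2 * ν) := by
  rw [hermiteScale, norm_div, norm_exp_I_mul, Complex.norm_real, Real.norm_eq_abs, div_pow,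
    sq_abs, Real.sq_sqrt hc.le, one_pow]

lemma norm_hermiteScale_sq_sub_one {ν : ℝ} (hc : 0 < Real.cos (2 * ν)) :
    ‖hermiteScale ν ^ 2 - 1‖ = Real.sqrt (1 / Real.cos (2 * ν) ^ 2 - 1) := by
  -- The square of the scale is `e^{2iν} / cos 2ν = 1 + i tan 2ν`.
  have h1 : hermiteScale ν ^ 2 - 1
      = ((Real.sin (2 * ν) / Real.cos (2 * ν) : ℝ) : ℂ) * Complex.I := by
    have hs : ((Real.sqrt (Real.cos (2 * ν)) : ℝ) : ℂ) ^ 2 = (Real.cos (2 * ν) : ℂ) := by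
      rw [← Complex.ofReal_pow, Real.sq_sqrt hc.le]
    have hc' : ((Real.cos (2 * ν) : ℝ) : ℂ) ≠ 0 := by exact_mod_cast hc.ne'
    have he : Complex.exp (Complex.I * ν) ^ 2
        = (Real.cos (2 * ν) : ℂ) + (Real.sin (2 * ν) : ℂ) * Complex.I := by
      rw [← Complex.exp_nat_mul, show ((2 : ℕ) : ℂ) * (Complex.I * ν)
        = ((2 * ν : ℝ) : ℂ) * Complex.I by push_cast; ring, Complex.exp_mul_I]
      simp
    rw [hermiteScale, div_pow, hs, he, Complex.ofReal_div]
    field_simp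
    ring
  rw [h1, norm_mul, Complex.norm_I, mul_one, Complex.norm_real, Real.norm_eq_abs,
    ← Real.sqrt_sq_eq_abs]
  congr 1
  rw [div_pow, Real.sin_sq]
  field_simp

lemma one_div_cos_pow_le_hermiteNormSq {ν : ℝ} (hc : 0 < Real.cos (2 * ν)) (n : ℕ) :
    (1 / Real.cos (2 * ν)) ^ n ≤ hermiteNormSq (hermiteScale ν) n := by
  rw [← norm_hermiteScale_sq hc]
  exact pow_le_hermiteNormSq _ n

lemma hermiteNormSq_le_growthRate_pow {ν : ℝ} (hc : 0 < Real.cos (2 * ν)) (n : ℕ) :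
    hermiteNormSq (hermiteScale ν) n ≤ growthRate ν ^ n := by
  rw [growthRate, ← norm_hermiteScale_sq hc, ← norm_hermiteScale_sq_sub_one hc]
  exact hermiteNormSq_le_pow _ n

/-- Only the real part `cos 2ν` of `e^{2iν}` contributes to the modulus of the exponential; scaling
by its square root restores the weight `exp (-y²)`. -/
lemma norm_sq_phi (N : ℂ) {ν : ℝ} (hc : 0 < Real.cos (2 * ν)) (n : ℕ) (x : ℝ) :
    ‖phi N ν n x‖ ^ 2 = ‖N‖ ^ 2 / (2 ^ n * n.factorial) *
      (‖(hermiteH n).eval (hermiteScale ν * ((Real.sqrt (Real.cos (2 * ν)) * x : ℝ) : ℂ))‖ ^ 2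
        * Real.exp (-(Real.sqrt (Real.cos (2 * ν)) * x) ^ 2)) := by
  have hs : ((Real.sqrt (Real.cos (2 * ν)) : ℝ) : ℂ) ≠ 0 := by
    exact_mod_cast (Real.sqrt_pos.2 hc).ne'
  have h1 : hermiteScale ν * ((Real.sqrt (Real.cos (2 * ν)) * x : ℝ) : ℂ)
      = Complex.exp (Complex.I * ν) * x := by
    rw [hermiteScale, Complex.ofReal_mul]
    field_simp
  have h2 : (-(1 / 2) * Complex.exp (2 * Complex.I * ν) * (x : ℂ) ^ 2).re
      = -(1 / 2) * (Real.cos (2 * ν) * x ^ 2) := by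
    rw [show 2 * Complex.I * (ν : ℂ) = ((2 * ν : ℝ) : ℂ) * Complex.I by push_cast; ring,
      show -(1 / 2) * Complex.exp (((2 * ν : ℝ) : ℂ) * Complex.I) * (x : ℂ) ^ 2
        = ((-(1 / 2) * x ^ 2 : ℝ) : ℂ) * Complex.exp (((2 * ν : ℝ) : ℂ) * Complex.I) by
          push_cast; ring, Complex.re_ofReal_mul, Complex.exp_ofReal_mul_I_re]
    ring
  rw [h1, phi, norm_mul, norm_mul, norm_div, Complex.norm_exp, h2, Complex.norm_real,
    Real.norm_eq_abs, mul_pow, mul_pow, div_pow, sq_abs, Real.sq_sqrt (by positivity),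
    ← Real.exp_nat_mul, mul_pow, Real.sq_sqrt hc.le]
  rw [mul_assoc]
  congr 3
  push_cast
  ring

lemma integral_norm_sq_phi (N : ℂ) {ν : ℝ} (hc : 0 < Real.cos (2 * ν)) (n : ℕ) :
    ∫ x : ℝ, ‖phi N ν n x‖ ^ 2
      = ‖N‖ ^ 2 * (Real.sqrt Real.pi / Real.sqrt (Real.cos (2 * ν)))
        * hermiteNormSq (hermiteScale ν) n := by
  have hs := Real.sqrt_pos.2 hc
  simp only [norm_sq_phi N hc]
  rw [integral_const_mul, Measure.integral_comp_mul_left (fun y : ℝ =>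
    ‖(hermiteH n).eval (hermiteScale ν * (y : ℂ))‖ ^ 2 * Real.exp (-y ^ 2)),
    integral_norm_sq_hermiteH, smul_eq_mul, abs_of_pos (inv_pos.2 hs)]
  have : (n.factorial : ℝ) ≠ 0 := by exact_mod_cast n.factorial_ne_zero
  field_simp

lemma continuous_phi (N : ℂ) (ν : ℝ) (n : ℕ) : Continuous (phi N ν n) := by
  unfold phi
  have := (hermiteH n).continuous
  fun_prop

lemma integrable_norm_sq_phi (N : ℂ) {ν : ℝ} (hc : 0 < Real.cos (2 * ν)) (n : ℕ) :
    Integrable fun x : ℝ => ‖phi N ν n x‖ ^ 2 := by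
  simp only [norm_sq_phi N hc]
  refine Integrable.const_mul ?_ _
  have h : Integrable fun y : ℝ =>
      ‖(hermiteH n).eval (hermiteScale ν * (y : ℂ))‖ ^ 2 * Real.exp (-y ^ 2) := by
    set p : ℂ[X] := (hermiteH n).comp (C (hermiteScale ν) * X) with hp
    refine (integrable_eval_mul_gaussian (p * p.map (starRingEnd ℂ))).norm.congr
      (Eventually.of_forall fun y => ?_)
    have h1 : p.eval (y : ℂ) = (hermiteH n).eval (hermiteScale ν * (y : ℂ)) := by simp [hp]
    simp only
    rw [eval_mul, eval_ofReal_map_conj, h1, norm_mul, norm_mul, RCLike.norm_conj,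
      Complex.norm_real, Real.norm_eq_abs, Real.abs_exp]
    ring
  exact h.comp_mul_left' (Real.sqrt_pos.2 hc).ne'

lemma memLp_phi (N : ℂ) {ν : ℝ} (hc : 0 < Real.cos (2 * ν)) (n : ℕ) :
    MemLp (phi N ν n) 2 volume :=
  (memLp_two_iff_integrable_sq_norm (continuous_phi N ν n).aestronglyMeasurable).2
    (integrable_norm_sq_phi N hc n)

lemma eLpNorm_two_eq_ofReal_sqrt {f : ℝ → ℂ} (hf : MemLp f 2 volume) :
    eLpNorm f 2 volume = ENNReal.ofReal (Real.sqrt (∫ x, ‖f x‖ ^ 2)) := by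
  rw [hf.eLpNorm_eq_integral_rpow_norm two_ne_zero ENNReal.ofNat_ne_top, Real.sqrt_eq_rpow]
  simp

end Norms

/-! ### Convergence of series in `L²`. -/

section Convergence

/-- A series in `L²` with summable norms converges. -/
lemma convergesAbsL2_of_tsum_lt_top {u : ℕ → ℝ → ℂ} (hu : ∀ k, MemLp (u k) 2 volume)
    (h : ∑' k, eLpNorm (u k) 2 volume < ∞) : ConvergesAbsL2 u := by
  refine ⟨⟨hu, ?_⟩, h⟩
  -- Completeness of `L²` provides the sum; the rest passes from classes to functions.
  have hsum : Summable fun k => (hu k).toLp (u k) := by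
    apply Summable.of_norm
    simp only [Lp.norm_toLp]
    exact ENNReal.summable_toReal h.ne
  obtain ⟨G, hG⟩ := hsum
  refine ⟨G, Lp.memLp G, ?_⟩
  have hpart : ∀ n, (∑ k ∈ Finset.range n, (hu k).toLp (u k) : Lp ℂ 2 (volume : Measure ℝ))
      =ᵐ[volume] fun x => ∑ k ∈ Finset.range n, u k x := by
    intro n
    induction n with
    | zero =>
      simp only [Finset.range_zero, Finset.sum_empty]
      exact Lp.coeFn_zero ℂ 2 (volume : Measure ℝ)
    | succ n ih =>
      rw [Finset.sum_range_succ]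
      filter_upwards [Lp.coeFn_add (∑ k ∈ Finset.range n, (hu k).toLp (u k))
        ((hu n).toLp (u n)), ih, (hu n).coeFn_toLp] with x h1 h2 h3
      rw [h1, Pi.add_apply, h2, h3, Finset.sum_range_succ]
  have ht := (Lp.tendsto_Lp_iff_tendsto_eLpNorm' _ _).1 hG.tendsto_sum_nat
  refine ht.congr fun n => eLpNorm_congr_ae ?_
  filter_upwards [hpart n] with x hx
  rw [Pi.sub_apply, hx]

/-- The terms of a series converging in `L²` tend to zero. -/
lemma ConvergesL2.tendsto_eLpNorm {u : ℕ → ℝ → ℂ} (h : ConvergesL2 u) :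
    Tendsto (fun k => eLpNorm (u k) 2 volume) atTop (𝓝 0) := by
  obtain ⟨hu, g, hg, ht⟩ := h
  have hm : ∀ n, AEStronglyMeasurable (fun x => (∑ k ∈ Finset.range n, u k x) - g x) volume :=
    fun n => ((memLp_finsetSum (Finset.range n) fun k _ => hu k).sub hg).aestronglyMeasurable
  have hb := (ht.comp (tendsto_add_atTop_nat 1)).add ht
  rw [add_zero] at hb
  refine tendsto_of_tendsto_of_tendsto_of_le_of_le tendsto_const_nhds hb (fun _ => zero_le)
    fun n => ?_
  -- `u n` is the difference of two consecutive errors, both tending to zero in norm.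
  have h1 := eLpNorm_sub_le (hm (n + 1)) (hm n) (p := 2) (by norm_num)
  have h2 : ((fun x => (∑ k ∈ Finset.range (n + 1), u k x) - g x)
      - fun x => (∑ k ∈ Finset.range n, u k x) - g x) = u n := by
    ext x
    simp [Finset.sum_range_succ]
  rwa [h2] at h1

end Convergence

/-! ### Size of the terms of the squeezed-state series. -/

section Series

lemma norm_lamB (z : ℂ) : ‖lamB z‖ = Real.tanh ‖z‖ / 2 := by
  have h : 0 ≤ Real.tanh ‖z‖ := by
    rw [Real.tanh_eq_sinh_div_cosh]
    exact div_nonneg (Real.sinh_nonneg_iff.2 (norm_nonneg z)) (Real.cosh_pos _).le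
  rw [lamB, norm_mul, norm_mul, norm_exp_I_mul, Complex.norm_real, Real.norm_eq_abs,
    abs_of_nonneg h]
  norm_num
  ring

/-- The scalar factor of the `k`-th term of a squeezed-state series. -/
noncomputable def squeezedCoeff (z : ℂ) (k : ℕ) : ℂ :=
  (Real.exp (lam z) : ℂ) * (lamB z ^ k / (k.factorial : ℂ)
    * (Real.sqrt ((2 * k).factorial : ℝ) : ℂ))

/-- Absorbing the scalar into the normalization constant lets every result on `phi` apply to the
terms. -/
lemma tauTerm_eq_phi (N : ℂ) (ν : ℝ) (z : ℂ) (k : ℕ) :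
    tauTerm N ν z k = phi (squeezedCoeff z k * N) ν (2 * k) := by
  ext x
  simp only [tauTerm, squeezedTerm, phi, squeezedCoeff]
  ring

lemma norm_sq_squeezedCoeff (z : ℂ) (k : ℕ) :
    ‖squeezedCoeff z k‖ ^ 2
      = Real.exp (lam z) ^ 2 * (k.centralBinom / 4 ^ k) * Real.tanh ‖z‖ ^ (2 * k) := by
  have h3 : (k.factorial : ℝ) ≠ 0 := by exact_mod_cast k.factorial_ne_zero
  rw [squeezedCoeff, norm_mul, norm_mul, norm_div, norm_pow, norm_lamB, RCLike.norm_natCast,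
    Complex.norm_real, Complex.norm_real, Real.norm_eq_abs, Real.norm_eq_abs, mul_pow, mul_pow,
    sq_abs, sq_abs, Real.sq_sqrt (by positivity), factorial_two_mul_eq_centralBinom_mul, div_pow, ← pow_mul, div_pow,
    mul_comm k 2, pow_mul 2 2 k, show ((2 : ℝ) ^ 2) = 4 by norm_num]
  field_simp

lemma memLp_tauTerm (N : ℂ) {ν : ℝ} (hc : 0 < Real.cos (2 * ν)) (z : ℂ) (k : ℕ) :
    MemLp (tauTerm N ν z k) 2 volume := by
  rw [tauTerm_eq_phi]
  exact memLp_phi _ hc _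

lemma integral_norm_sq_tauTerm (N : ℂ) {ν : ℝ} (hc : 0 < Real.cos (2 * ν)) (z : ℂ) (k : ℕ) :
    ∫ x, ‖tauTerm N ν z k x‖ ^ 2
      = (Real.exp (lam z) * ‖N‖) ^ 2 * (Real.sqrt Real.pi / Real.sqrt (Real.cos (2 * ν)))
        * (k.centralBinom / 4 ^ k)
        * (Real.tanh ‖z‖ ^ (2 * k) * hermiteNormSq (hermiteScale ν) (2 * k)) := by
  rw [tauTerm_eq_phi, integral_norm_sq_phi _ hc, norm_mul, mul_pow, norm_sq_squeezedCoeff]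
  ring

lemma tanh_norm_nonneg (z : ℂ) : 0 ≤ Real.tanh ‖z‖ := by
  have := norm_nonneg (lamB z)
  rw [norm_lamB] at this
  linarith

lemma growthRate_pos {ν : ℝ} (hc : 0 < Real.cos (2 * ν)) : 0 < growthRate ν :=
  add_pos_of_pos_of_nonneg (one_div_pos.2 hc) (Real.sqrt_nonneg _)

/-- Absolute convergence where `tanh |z|` is below the inverse growth rate. -/
lemma convergesAbsL2_tauTerm (N : ℂ) {ν : ℝ} (hc : 0 < Real.cos (2 * ν)) {z : ℂ}
    (hz : Real.tanh ‖z‖ * growthRate ν < 1) : ConvergesAbsL2 (tauTerm N ν z) := by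
  refine convergesAbsL2_of_tsum_lt_top (memLp_tauTerm N hc z) ?_
  set D : ℝ := (Real.exp (lam z) * ‖N‖) ^ 2
    * (Real.sqrt Real.pi / Real.sqrt (Real.cos (2 * ν))) with hD
  have hD0 : 0 ≤ D := by positivity
  set q := Real.tanh ‖z‖ * growthRate ν with hq
  have hq0 : 0 ≤ q := mul_nonneg (tanh_norm_nonneg z) (growthRate_pos hc).le
  have hle : ∀ k, eLpNorm (tauTerm N ν z k) 2 volume ≤ ENNReal.ofReal (Real.sqrt D * q ^ k) := by
    intro k
    rw [eLpNorm_two_eq_ofReal_sqrt (memLp_tauTerm N hc z k), integral_norm_sq_tauTerm N hc]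
    apply ENNReal.ofReal_le_ofReal
    rw [← Real.sqrt_sq (pow_nonneg hq0 k), ← Real.sqrt_mul hD0]
    apply Real.sqrt_le_sqrt
    have h1 : (k.centralBinom : ℝ) / 4 ^ k ≤ 1 :=
      (div_le_one (by positivity)).2 (by exact_mod_cast k.centralBinom_le_four_pow)
    have h2 : Real.tanh ‖z‖ ^ (2 * k) * hermiteNormSq (hermiteScale ν) (2 * k) ≤ (q ^ k) ^ 2 := by
      rw [← pow_mul, mul_comm k 2, hq, mul_pow]
      exact mul_le_mul_of_nonneg_left (hermiteNormSq_le_growthRate_pow hc _)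
        (pow_nonneg (tanh_norm_nonneg z) _)
    exact mul_le_mul (mul_le_of_le_one_right hD0 h1) h2
      (mul_nonneg (pow_nonneg (tanh_norm_nonneg z) _)
        (le_trans (by positivity) (one_div_cos_pow_le_hermiteNormSq hc _))) hD0
  refine lt_of_le_of_lt (ENNReal.tsum_le_tsum hle) ?_
  have hs : Summable fun k : ℕ => Real.sqrt D * q ^ k :=
    (summable_geometric_of_lt_one hq0 hz).mul_left _
  rw [← ENNReal.ofReal_tsum_of_nonneg (fun k => by positivity) hs]
  exact ENNReal.ofReal_lt_top

/-- Convergence forces `tanh |z| ≤ cos 2ν`. -/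
lemma tanh_le_cos_of_convergesL2_tauTerm {N : ℂ} (hN : N ≠ 0) {ν : ℝ}
    (hc : 0 < Real.cos (2 * ν)) {z : ℂ} (h : ConvergesL2 (tauTerm N ν z)) :
    Real.tanh ‖z‖ ≤ Real.cos (2 * ν) := by
  by_contra! hlt
  set q := Real.tanh ‖z‖ * (1 / Real.cos (2 * ν)) with hq
  have hq1 : 1 < q := by rw [hq, mul_one_div, one_lt_div hc]; exact hlt
  set D : ℝ := (Real.exp (lam z) * ‖N‖) ^ 2
    * (Real.sqrt Real.pi / Real.sqrt (Real.cos (2 * ν))) with hD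
  have hN' : 0 < ‖N‖ := norm_pos_iff.2 hN
  have hpi := Real.pi_pos
  have hD0 : 0 < D := by positivity
  -- Chosen so that Bernoulli gives `q^{2k} ≥ 1 + 2k(q - 1) ≥ (2k + 1) ε`, which cancels the loss
  -- `1/(2k + 1)` from the central binomial coefficient.
  set ε := min 1 (q - 1) with hε
  have hε0 : 0 < ε := lt_min one_pos (by linarith)
  have hge : ∀ k, ENNReal.ofReal (Real.sqrt (D * ε)) ≤ eLpNorm (tauTerm N ν z k) 2 volume := by
    intro k
    rw [eLpNorm_two_eq_ofReal_sqrt (memLp_tauTerm N hc z k), integral_norm_sq_tauTerm N hc]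
    apply ENNReal.ofReal_le_ofReal
    apply Real.sqrt_le_sqrt
    rw [← hD, mul_assoc D]
    apply mul_le_mul_of_nonneg_left _ hD0.le
    have h1 : (1 : ℝ) / (2 * k + 1) ≤ k.centralBinom / 4 ^ k := by
      rw [div_le_div_iff₀ (by positivity) (by positivity)]
      have := Nat.four_pow_le_two_mul_add_one_mul_central_binom k
      have h' : (4 : ℝ) ^ k ≤ (2 * k + 1) * k.centralBinom := by exact_mod_cast this
      linarith
    have h2 : (2 * k + 1) * ε
        ≤ Real.tanh ‖z‖ ^ (2 * k) * hermiteNormSq (hermiteScale ν) (2 * k) := by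
      calc (2 * k + 1) * ε ≤ 1 + (2 * k : ℕ) * (q - 1) := by
            have := min_le_left 1 (q - 1)
            have h3 := mul_le_mul_of_nonneg_left (min_le_right 1 (q - 1))
              (by positivity : (0 : ℝ) ≤ 2 * k)
            push_cast
            linarith
        _ ≤ (1 + (q - 1)) ^ (2 * k) := one_add_mul_le_pow (by linarith) _
        _ = Real.tanh ‖z‖ ^ (2 * k) * (1 / Real.cos (2 * ν)) ^ (2 * k) := by
            rw [add_sub_cancel, hq, mul_pow]
        _ ≤ _ := mul_le_mul_of_nonneg_left (one_div_cos_pow_le_hermiteNormSq hc _)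
            (pow_nonneg (tanh_norm_nonneg z) _)
    calc ε = 1 / (2 * k + 1) * ((2 * k + 1) * ε) := by field_simp
      _ ≤ _ := mul_le_mul h1 h2 (by positivity) (by positivity)
  have h0 := ge_of_tendsto' h.tendsto_eLpNorm hge
  rw [nonpos_iff_eq_zero, ENNReal.ofReal_eq_zero] at h0
  exact absurd h0 (not_le.2 (Real.sqrt_pos.2 (mul_pos hD0 hε0)))

end Series

end Swanson

namespace Swanson

/-! ### The radius `ρ_ν` and the limits in `ν`. -/

section Radius

lemma rho_eq_artanh (ν : ℝ) : rho ν = Real.artanh ((growthRate ν ^ 2)⁻¹) := rfl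

lemma cos_two_mul_lt_one {ν : ℝ} (hν : ν ∈ Ioo (-(Real.pi / 4)) (Real.pi / 4)) (h0 : ν ≠ 0) :
    Real.cos (2 * ν) < 1 := by
  refine lt_of_le_of_ne (Real.cos_le_one _) fun h => h0 ?_
  have hpi := Real.pi_pos
  have := (Real.cos_eq_one_iff_of_lt_of_lt (by linarith [hν.1]) (by linarith [hν.2])).1 h
  linarith

lemma inv_growthRate_sq_mem {ν : ℝ} (hc : 0 < Real.cos (2 * ν)) (hc1 : Real.cos (2 * ν) < 1) :
    0 < (growthRate ν ^ 2)⁻¹ ∧ (growthRate ν ^ 2)⁻¹ ≤ Real.cos (2 * ν) ^ 2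
      ∧ (growthRate ν ^ 2)⁻¹ < 1 := by
  have h1 : (growthRate ν ^ 2)⁻¹ ≤ Real.cos (2 * ν) ^ 2 := by
    rw [← inv_pow]
    have h : 1 / Real.cos (2 * ν) ≤ growthRate ν := le_add_of_nonneg_right (Real.sqrt_nonneg _)
    have h' : (growthRate ν)⁻¹ ≤ Real.cos (2 * ν) := by
      rw [one_div] at h
      exact inv_le_of_inv_le₀ hc h
    exact pow_le_pow_left₀ (inv_pos.2 (growthRate_pos hc)).le h' 2
  exact ⟨inv_pos.2 (pow_pos (growthRate_pos hc) 2), h1,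
    h1.trans_lt (pow_lt_one₀ hc.le hc1 two_ne_zero)⟩

lemma rho_pos {ν : ℝ} (hc : 0 < Real.cos (2 * ν)) (hc1 : Real.cos (2 * ν) < 1) : 0 < rho ν := by
  obtain ⟨h0, -, h1⟩ := inv_growthRate_sq_mem hc hc1
  exact Real.artanh_pos ⟨h0, h1⟩

lemma rho_le_artanh {ν : ℝ} (hc : 0 < Real.cos (2 * ν)) (hc1 : Real.cos (2 * ν) < 1) :
    rho ν ≤ Real.artanh (Real.cos (2 * ν) ^ 2) := by
  obtain ⟨h0, h1, -⟩ := inv_growthRate_sq_mem hc hc1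
  exact Real.artanh_le_artanh (neg_one_lt_zero.trans h0) (pow_lt_one₀ hc.le hc1 two_ne_zero) h1

lemma rho_neg (ν : ℝ) : rho (-ν) = rho ν := by simp [rho]

/-- The definition of `ρ_ν` gives `tanh |z| < A⁻²` with `A` the growth rate, and `A⁻² < A⁻¹` because
`A > 1`. -/
lemma tanh_mul_growthRate_lt_one {ν : ℝ} (hc : 0 < Real.cos (2 * ν))
    (hc1 : Real.cos (2 * ν) < 1) {z : ℂ} (hz : ‖z‖ < rho ν) :
    Real.tanh ‖z‖ * growthRate ν < 1 := by
  obtain ⟨h0, -, h1⟩ := inv_growthRate_sq_mem hc hc1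
  have hA := growthRate_pos hc
  have hA1 : 1 < growthRate ν := by
    have := (one_lt_inv₀ h0).2 h1
    rw [inv_inv] at this
    exact (one_lt_pow_iff_of_nonneg hA.le two_ne_zero).1 this
  have h2 : Real.tanh ‖z‖ < (growthRate ν ^ 2)⁻¹ := by
    rw [← Real.artanh_tanh ‖z‖, rho_eq_artanh] at hz
    exact (Real.artanh_lt_artanh_iff ⟨Real.neg_one_lt_tanh _, Real.tanh_lt_one _⟩
      ⟨by linarith, h1⟩).1 hz
  calc Real.tanh ‖z‖ * growthRate ν < (growthRate ν ^ 2)⁻¹ * growthRate ν :=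
        mul_lt_mul_of_pos_right h2 hA
    _ = (growthRate ν)⁻¹ := by field_simp
    _ < 1 := inv_lt_one_of_one_lt₀ hA1

lemma kappaTerm_eq_tauTerm (N : ℂ) (ν : ℝ) : kappaTerm N ν = tauTerm N (-ν) := by
  have h : psi N ν = phi N (-ν) := by
    ext n x
    simp [psi, phi]
  ext1 z
  rw [kappaTerm, tauTerm, h]

lemma continuousAt_artanh_zero : ContinuousAt Real.artanh 0 := by
  unfold Real.artanh
  refine ContinuousAt.log (ContinuousAt.sqrt (ContinuousAt.div ?_ ?_ ?_)) ?_
  · fun_prop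
  · fun_prop
  · norm_num
  · norm_num

lemma tendsto_artanh_nhdsLT_one : Tendsto Real.artanh (𝓝[<] 1) atTop := by
  unfold Real.artanh
  refine Real.tendsto_log_atTop.comp (Real.tendsto_sqrt_atTop.comp ?_)
  have h1 : Tendsto (fun x : ℝ => 1 + x) (𝓝[<] 1) (𝓝 2) := by
    have : Tendsto (fun x : ℝ => 1 + x) (𝓝 1) (𝓝 (1 + 1)) := by
      exact (continuous_const.add continuous_id).tendsto 1
    rw [one_add_one_eq_two] at this
    exact this.mono_left nhdsWithin_le_nhds
  have h2 : Tendsto (fun x : ℝ => 1 - x) (𝓝[<] 1) (𝓝[>] 0) := by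
    refine tendsto_nhdsWithin_iff.2 ⟨?_, ?_⟩
    · have : Tendsto (fun x : ℝ => 1 - x) (𝓝 1) (𝓝 (1 - 1)) :=
        (continuous_const.sub continuous_id).tendsto 1
      rw [sub_self] at this
      exact this.mono_left nhdsWithin_le_nhds
    · filter_upwards [self_mem_nhdsWithin] with x hx
      exact sub_pos.2 (mem_Iio.1 hx)
  simp only [div_eq_mul_inv]
  exact h1.pos_mul_atTop two_pos (tendsto_inv_nhdsGT_zero.comp h2)

lemma tendsto_cos_two_mul {ν₀ : ℝ} {l : Filter ℝ} (hl : l ≤ 𝓝 ν₀) :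
    Tendsto (fun ν => Real.cos (2 * ν)) l (𝓝 (Real.cos (2 * ν₀))) :=
  (Continuous.tendsto (by fun_prop) ν₀).mono_left hl

lemma eventually_nhdsNE_zero :
    ∀ᶠ ν in 𝓝[≠] (0 : ℝ), ν ∈ Ioo (-(Real.pi / 4)) (Real.pi / 4) ∧ ν ≠ 0 := by
  have hpi := Real.pi_pos
  exact (eventually_nhdsWithin_of_eventually_nhds
    (Ioo_mem_nhds (by linarith) (by linarith))).and self_mem_nhdsWithin

lemma tendsto_rho_nhdsNE_zero : Tendsto rho (𝓝[≠] 0) atTop := by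
  refine tendsto_artanh_nhdsLT_one.comp (tendsto_nhdsWithin_iff.2 ⟨?_, ?_⟩)
  · have hc : Tendsto (fun ν => Real.cos (2 * ν)) (𝓝[≠] 0) (𝓝 1) := by
      simpa using tendsto_cos_two_mul (ν₀ := 0) nhdsWithin_le_nhds
    -- The argument of `artanh` depends on `ν` only through `c = cos 2ν`, and equals `1` at `c = 1`.
    have hA : ContinuousAt (fun c : ℝ => ((1 / c + Real.sqrt (1 / c ^ 2 - 1)) ^ 2)⁻¹) 1 := by
      refine ContinuousAt.inv₀ (ContinuousAt.pow (ContinuousAt.add ?_ (ContinuousAt.sqrt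
        (ContinuousAt.sub ?_ ?_))) 2) (by norm_num)
      · exact continuousAt_const.div continuousAt_id one_ne_zero
      · exact continuousAt_const.div (continuousAt_id.pow 2) (by norm_num)
      · exact continuousAt_const
    have := hA.tendsto.comp hc
    simpa [Function.comp_def] using this
  · filter_upwards [eventually_nhdsNE_zero] with ν hν
    exact (inv_growthRate_sq_mem (cos_two_mul_pos hν.1) (cos_two_mul_lt_one hν.1 hν.2)).2.2

lemma tendsto_artanh_cos_two_mul {ν₀ : ℝ} {l : Filter ℝ} (hl : l ≤ 𝓝 ν₀)
    (h0 : Real.cos (2 * ν₀) = 0) : Tendsto (fun ν => Real.artanh (Real.cos (2 * ν))) l (𝓝 0) := by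
  have h := tendsto_cos_two_mul hl
  rw [h0] at h
  have := continuousAt_artanh_zero.tendsto.comp h
  rwa [Real.artanh_zero] at this

lemma tendsto_rho_zero {ν₀ : ℝ} {l : Filter ℝ} (hl : l ≤ 𝓝 ν₀) (h0 : Real.cos (2 * ν₀) = 0)
    (hev : ∀ᶠ ν in l, ν ∈ Ioo (-(Real.pi / 4)) (Real.pi / 4) ∧ ν ≠ 0) :
    Tendsto rho l (𝓝 0) := by
  refine tendsto_of_tendsto_of_tendsto_of_le_of_le' tendsto_const_nhds
    (tendsto_artanh_cos_two_mul hl h0) ?_ ?_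
  · filter_upwards [hev] with ν hν
    exact (rho_pos (cos_two_mul_pos hν.1) (cos_two_mul_lt_one hν.1 hν.2)).le
  · filter_upwards [hev] with ν hν
    have hc := cos_two_mul_pos hν.1
    have hc1 := cos_two_mul_lt_one hν.1 hν.2
    -- Here `cos² 2ν ≤ cos 2ν` since the cosine lies in `(0, 1)`.
    exact (rho_le_artanh hc hc1).trans
      (Real.artanh_le_artanh (by nlinarith) hc1 (by nlinarith))

lemma ofReal_rho_le_radius (N : ℂ) {ν : ℝ} (hc : 0 < Real.cos (2 * ν))
    (hc1 : Real.cos (2 * ν) < 1) : ENNReal.ofReal (rho ν) ≤ radius (tauTerm N ν) := by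
  refine le_iSup₂_of_le (rho ν).toNNReal (fun z hz => ?_) le_rfl
  rw [Real.coe_toNNReal _ (rho_pos hc hc1).le] at hz
  exact (convergesAbsL2_tauTerm N hc (tanh_mul_growthRate_lt_one hc hc1 hz)).1

lemma radius_le_ofReal_artanh {N : ℂ} (hN : N ≠ 0) {ν : ℝ} (hc : 0 < Real.cos (2 * ν))
    (hc1 : Real.cos (2 * ν) < 1) :
    radius (tauTerm N ν) ≤ ENNReal.ofReal (Real.artanh (Real.cos (2 * ν))) := by
  refine iSup₂_le fun r hr => ?_
  have h : (r : ℝ) ≤ Real.artanh (Real.cos (2 * ν)) := by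
    refine le_of_forall_lt_imp_le_of_dense fun s hs => ?_
    rcases lt_or_ge s 0 with h0 | h0
    · exact h0.le.trans (Real.artanh_nonneg hc.le)
    -- The real point `z = s` lies inside the disc of radius `r`, so convergence there bounds `tanh
    -- s`.
    · have hn : ‖(s : ℂ)‖ = s := by rw [Complex.norm_real, Real.norm_of_nonneg h0]
      have := tanh_le_cos_of_convergesL2_tauTerm hN hc (hr s (by rwa [hn]))
      rw [hn] at this
      rw [← Real.artanh_tanh s]
      exact Real.artanh_le_artanh (Real.neg_one_lt_tanh s) hc1 this
  rw [← ENNReal.ofReal_coe_nnreal]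
  exact ENNReal.ofReal_le_ofReal h

lemma eventually_nhdsLT_pi_div_four :
    ∀ᶠ ν in 𝓝[<] (Real.pi / 4), ν ∈ Ioo (-(Real.pi / 4)) (Real.pi / 4) ∧ ν ≠ 0 := by
  have hpi := Real.pi_pos
  filter_upwards [Ioo_mem_nhdsLT (show 0 < Real.pi / 4 by linarith)] with ν hν
  exact ⟨⟨by linarith [hν.1], hν.2⟩, hν.1.ne'⟩

lemma eventually_nhdsGT_neg_pi_div_four :
    ∀ᶠ ν in 𝓝[>] (-(Real.pi / 4)), ν ∈ Ioo (-(Real.pi / 4)) (Real.pi / 4) ∧ ν ≠ 0 := by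
  have hpi := Real.pi_pos
  filter_upwards [Ioo_mem_nhdsGT (show -(Real.pi / 4) < 0 by linarith)] with ν hν
  exact ⟨⟨hν.1, by linarith [hν.2]⟩, hν.2.ne⟩

lemma cos_two_mul_pi_div_four : Real.cos (2 * (Real.pi / 4)) = 0 := by
  rw [show 2 * (Real.pi / 4) = Real.pi / 2 by ring, Real.cos_pi_div_two]

lemma cos_two_mul_neg_pi_div_four : Real.cos (2 * -(Real.pi / 4)) = 0 := by
  rw [mul_neg, Real.cos_neg, cos_two_mul_pi_div_four]

/-- Limits of a function of `ν` squeezed between `ρ_ν` and `tanh⁻¹ (cos 2ν)`. -/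
lemma tendsto_of_rho_le_of_le_artanh {R : ℝ → ℝ≥0∞}
    (h : ∀ ν ∈ Ioo (-(Real.pi / 4)) (Real.pi / 4), ν ≠ 0 →
      ENNReal.ofReal (rho ν) ≤ R ν ∧ R ν ≤ ENNReal.ofReal (Real.artanh (Real.cos (2 * ν)))) :
    Tendsto R (𝓝[<] (Real.pi / 4)) (𝓝 0) ∧ Tendsto R (𝓝[>] (-(Real.pi / 4))) (𝓝 0) ∧
      Tendsto R (𝓝[≠] 0) (𝓝 ∞) := by
  have h0 : ∀ {ν₀ : ℝ} {l : Filter ℝ}, l ≤ 𝓝 ν₀ → Real.cos (2 * ν₀) = 0 →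
      (∀ᶠ ν in l, ν ∈ Ioo (-(Real.pi / 4)) (Real.pi / 4) ∧ ν ≠ 0) → Tendsto R l (𝓝 0) := by
    intro ν₀ l hl hc hev
    have ht := ENNReal.tendsto_ofReal (tendsto_artanh_cos_two_mul hl hc)
    rw [ENNReal.ofReal_zero] at ht
    refine tendsto_of_tendsto_of_tendsto_of_le_of_le' tendsto_const_nhds ht
      (Eventually.of_forall fun _ => zero_le) ?_
    filter_upwards [hev] with ν hν using (h ν hν.1 hν.2).2
  refine ⟨h0 nhdsWithin_le_nhds cos_two_mul_pi_div_four eventually_nhdsLT_pi_div_four,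
    h0 nhdsWithin_le_nhds cos_two_mul_neg_pi_div_four eventually_nhdsGT_neg_pi_div_four, ?_⟩
  refine tendsto_of_tendsto_of_tendsto_of_le_of_le'
    (ENNReal.tendsto_ofReal_atTop.comp tendsto_rho_nhdsNE_zero) tendsto_const_nhds ?_
    (Eventually.of_forall fun _ => le_top)
  filter_upwards [eventually_nhdsNE_zero] with ν hν using (h ν hν.1 hν.2).1

end Radius

end Swanson

theorem mainTheorem5 (N₁ N₂ : ℝ → ℂ)
    (hN₁ : ∀ ν ∈ Ioo (-(Real.pi / 4)) (Real.pi / 4), N₁ ν ≠ 0)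
    (hN₂ : ∀ ν ∈ Ioo (-(Real.pi / 4)) (Real.pi / 4), N₂ ν ≠ 0) :
    -- convergence of both states in the ball of radius `ρ_ν`
    (∀ ν ∈ Ioo (-(Real.pi / 4)) (Real.pi / 4), ν ≠ 0 →
      0 < Swanson.rho ν ∧
      ∀ z : ℂ, ‖z‖ < Swanson.rho ν →
        Swanson.ConvergesAbsL2 (Swanson.tauTerm (N₁ ν) ν z) ∧
        Swanson.ConvergesAbsL2 (Swanson.kappaTerm (N₂ ν) ν z)) ∧
    -- for `ν = 0` both states converge in the whole complex plane
    (∀ z : ℂ, Swanson.ConvergesAbsL2 (Swanson.tauTerm (N₁ 0) 0 z) ∧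
      Swanson.ConvergesAbsL2 (Swanson.kappaTerm (N₂ 0) 0 z)) ∧
    -- the radius `ρ_ν` shrinks to zero as `ν → ± π/4` and becomes infinite as `ν → 0`
    (Tendsto Swanson.rho (𝓝[<] (Real.pi / 4)) (𝓝 0) ∧
      Tendsto Swanson.rho (𝓝[>] (-(Real.pi / 4))) (𝓝 0) ∧
      Tendsto Swanson.rho (𝓝[≠] 0) atTop) ∧
    -- and so does the radius of convergence of the series of `τ_z`
    (Tendsto (fun ν => Swanson.radius (Swanson.tauTerm (N₁ ν) ν)) (𝓝[<] (Real.pi / 4)) (𝓝 0) ∧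
      Tendsto (fun ν => Swanson.radius (Swanson.tauTerm (N₁ ν) ν)) (𝓝[>] (-(Real.pi / 4))) (𝓝 0) ∧
      Tendsto (fun ν => Swanson.radius (Swanson.tauTerm (N₁ ν) ν)) (𝓝[≠] 0) (𝓝 ∞)) ∧
    -- and of the series of `κ_z`
    (Tendsto (fun ν => Swanson.radius (Swanson.kappaTerm (N₂ ν) ν)) (𝓝[<] (Real.pi / 4)) (𝓝 0) ∧
      Tendsto (fun ν => Swanson.radius (Swanson.kappaTerm (N₂ ν) ν)) (𝓝[>] (-(Real.pi / 4)))
        (𝓝 0) ∧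
      Tendsto (fun ν => Swanson.radius (Swanson.kappaTerm (N₂ ν) ν)) (𝓝[≠] 0) (𝓝 ∞)) := by
  have hmem : ∀ ν ∈ Ioo (-(Real.pi / 4)) (Real.pi / 4), ν ≠ 0 →
      0 < Real.cos (2 * ν) ∧ Real.cos (2 * ν) < 1 :=
    fun ν hν h0 => ⟨Swanson.cos_two_mul_pos hν, Swanson.cos_two_mul_lt_one hν h0⟩
  have hneg : ∀ ν : ℝ, Real.cos (2 * -ν) = Real.cos (2 * ν) := fun ν => by
    rw [mul_neg, Real.cos_neg]
  refine ⟨fun ν hν h0 => ?_, fun z => ?_, ⟨?_, ?_, Swanson.tendsto_rho_nhdsNE_zero⟩, ?_, ?_⟩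
  · obtain ⟨hc, hc1⟩ := hmem ν hν h0
    refine ⟨Swanson.rho_pos hc hc1, fun z hz => ⟨Swanson.convergesAbsL2_tauTerm _ hc
      (Swanson.tanh_mul_growthRate_lt_one hc hc1 hz), ?_⟩⟩
    rw [← Swanson.rho_neg] at hz
    rw [← hneg] at hc hc1
    rw [Swanson.kappaTerm_eq_tauTerm]
    exact Swanson.convergesAbsL2_tauTerm _ hc (Swanson.tanh_mul_growthRate_lt_one hc hc1 hz)
  · have hc : 0 < Real.cos (2 * 0) := by simp
    -- At `ν = 0` the growth rate equals `1`.
    have hz : Real.tanh ‖z‖ * Swanson.growthRate 0 < 1 := by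
      simpa [Swanson.growthRate] using Real.tanh_lt_one ‖z‖
    rw [Swanson.kappaTerm_eq_tauTerm, neg_zero]
    exact ⟨Swanson.convergesAbsL2_tauTerm _ hc hz, Swanson.convergesAbsL2_tauTerm _ hc hz⟩
  · exact Swanson.tendsto_rho_zero nhdsWithin_le_nhds Swanson.cos_two_mul_pi_div_four
      Swanson.eventually_nhdsLT_pi_div_four
  · exact Swanson.tendsto_rho_zero nhdsWithin_le_nhds Swanson.cos_two_mul_neg_pi_div_four
      Swanson.eventually_nhdsGT_neg_pi_div_four
  · refine Swanson.tendsto_of_rho_le_of_le_artanh fun ν hν h0 => ?_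
    obtain ⟨hc, hc1⟩ := hmem ν hν h0
    exact ⟨Swanson.ofReal_rho_le_radius _ hc hc1,
      Swanson.radius_le_ofReal_artanh (hN₁ ν hν) hc hc1⟩
  · refine Swanson.tendsto_of_rho_le_of_le_artanh fun ν hν h0 => ?_
    obtain ⟨hc, hc1⟩ := hmem ν hν h0
    rw [Swanson.kappaTerm_eq_tauTerm, ← Swanson.rho_neg, ← hneg]
    rw [← hneg] at hc hc1
    exact ⟨Swanson.ofReal_rho_le_radius _ hc hc1,
      Swanson.radius_le_ofReal_artanh (hN₂ ν hν) hc hc1⟩
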